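/- Let $G=(V,E)$ be a finite simple graph with maximum degree $\Delta\ge 2$. For $k\ge 2$ let $G^k$ be the $k$-th power hypergraph of $G$: the $k$-uniform hypergraph obtained from $G$ by adding to each edge $e\in E$ its own $k-2$ new vertices, so that $V(G^k)$ consists of $V$ and of all the new vertices, and the edges of $G^k$ are the sets $e\cup\{i_{e,1},\dots,i_{e,k-2}\}$ with $e\in E$ (in particular $G^2=G$). For a $k$-uniform hypergraph $H$ with vertex set $[n]$, let $\mathcal A(H)$ be the tensor of order $k$ and dimension $n$ whose entry at $(i_1,\dots,i_k)$ is $\frac1{(k-1)!}$ if $\{i_1,\dots,i_k\}\in E(H)$ and $0$ otherwise, let $\mathcal D(H)$ be the diagonal tensor whose entry at $(i,\dots,i)$ is the number of edges that contain $i$, and let $\mathcal L(H)=\mathcal D(H)-\mathcal A(H)$ and $\mathcal Q(H)=\mathcal D(H)+\mathcal A(H)$ be the Laplacian and the signless Laplacian tensor. An H-eigenvalue of a real tensor $\mathcal T$ of order $k$ and dimension $n$ is a real number $\mu$ such that $\sum_{i_2,\dots,i_k=1}^n\mathcal T_{ii_2\cdots i_k}x_{i_2}\cdots x_{i_k}=\mu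 x_i^{k-1}$ for all $i\in[n]$, for some nonzero $x\in\mathbb R^n$; the largest H-eigenvalue is denoted by $\lambda(\mathcal T)$. Then $\lambda(\mathcal Q(G^k))$ exists for every even $k\ge 2$, and $\lambda(\mathcal L(G^k))$ exists and satisfies $\lambda(\mathcal L(G^k))=\lambda(\mathcal Q(G^k))$ for every even $k\ge 4$. Moreover, $\lambda(\mathcal Q(G^k))$ is strictly decreasing in $k$ over the even integers $k\ge 2$; hence the common value $\lambda(\mathcal L(G^k))=\lambda(\mathcal Q(G^k))$ is strictly decreasing in $k$ over the even integers $k\ge 4$. -/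

import Mathlib

open scoped Nat

/-- A `k`-uniform hypergraph whose vertex set is the whole type `W`. -/
structure UniformHypergraph (W : Type*) (k : ℕ) extends Hypergraph W where
  vertexSet_eq_univ : vertexSet = Set.univ
  ncard_eq_of_mem_edgeSet : ∀ e ∈ edgeSet, e.ncard = k

/-- Real tensors of order `k` (with `1 ≤ k`) and dimension `|W|`, indexed by `W`. The first index is
separated from the other `k - 1` ones: `T i j` is the entry `T_{i j_1 … j_{k-1}}`. -/
abbrev HTensor (k : ℕ) (W : Type*) : Type _ := W → (Fin (k - 1) → W) → ℝ

namespace HTensor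

variable {k : ℕ} {W : Type*}

/-- The vector `T x`, with `(T x)_i = ∑_{i_2, …, i_k} T_{i i_2 … i_k} x_{i_2} ⋯ x_{i_k}`. -/
noncomputable def apply [Fintype W] (T : HTensor k W) (x : W → ℝ) : W → ℝ :=
  fun i => ∑ j : Fin (k - 1) → W, T i j * ∏ t, x (j t)

/-- The H-spectrum: all `μ` such that `T x = μ x^{[k-1]}` for some nonzero real vector `x`.
(For a real tensor, an eigenvalue with a real eigenvector is automatically real.) -/
def hSpec [Fintype W] (T : HTensor k W) : Set ℝ :=
  {μ | ∃ x : W → ℝ, x ≠ 0 ∧ ∀ i, T.apply x i = μ * x i ^ (k - 1)}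

/-- The largest H-eigenvalue `λ(T)`. Meaningful when the H-spectrum has a greatest element. -/
noncomputable def largestHEigenvalue [Fintype W] (T : HTensor k W) : ℝ :=
  sSup T.hSpec

end HTensor

namespace UniformHypergraph

variable {k : ℕ} {W : Type*}

/-- The number of edges that contain the vertex `v`. -/
noncomputable def degree (H : UniformHypergraph W k) (v : W) : ℕ :=
  {e | e ∈ H.edgeSet ∧ v ∈ e}.ncard

open Classical in
/-- The adjacency tensor: the entry at `i, j_1, …, j_{k-1}` is `1 / (k - 1)!` if
`{i, j_1, …, j_{k-1}}` is an edge, and `0` otherwise. -/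
noncomputable def adjacencyTensor (H : UniformHypergraph W k) : HTensor k W :=
  fun i j => if insert i (Set.range j) ∈ H.edgeSet then 1 / ((k - 1)! : ℝ) else 0

open Classical in
/-- The diagonal tensor of the vertex degrees. -/
noncomputable def degreeTensor (H : UniformHypergraph W k) : HTensor k W :=
  fun i j => if ∀ t, j t = i then (H.degree i : ℝ) else 0

/-- The Laplacian tensor `L = D - A`. -/
noncomputable def laplacianTensor (H : UniformHypergraph W k) : HTensor k W :=
  H.degreeTensor - H.adjacencyTensor

/-- The signless Laplacian tensor `Q = D + A`. -/
noncomputable def signlessLaplacianTensor (H : UniformHypergraph W k) : HTensor k W :=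
  H.degreeTensor + H.adjacencyTensor

end UniformHypergraph

namespace SimpleGraph

variable {V : Type*}

/-- The vertices of the `k`-th power of `G`: those of `G`, and `k - 2` new ones for each edge. -/
abbrev PowerVertex (G : SimpleGraph V) (k : ℕ) : Type _ := V ⊕ (G.edgeSet × Fin (k - 2))

/-- The edge of the `k`-th power of `G` that extends the edge `e` of `G` by the new vertices
of `e`. -/
def powerEdge (G : SimpleGraph V) (k : ℕ) (e : G.edgeSet) : Set (G.PowerVertex k) :=
  Sum.inl '' {v | v ∈ (e : Sym2 V)} ∪ Sum.inr '' {p | p.1 = e}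

theorem ncard_powerEdge (G : SimpleGraph V) (k : ℕ) (hk : 2 ≤ k) (e : G.edgeSet) :
    (G.powerEdge k e).ncard = k := by
  obtain ⟨e, he⟩ := e
  induction e using Sym2.ind with
  | _ a b =>
    have hab : a ≠ b := G.ne_of_adj (by simpa using he)
    have h1 : {v | v ∈ s(a, b)} = ({a, b} : Set V) := by ext; simp
    have h2 : {p : G.edgeSet × Fin (k - 2) | p.1 = ⟨s(a, b), he⟩} =
        Prod.mk ⟨s(a, b), he⟩ '' Set.univ := by
      ext ⟨p, t⟩; simp [eq_comm]
    unfold powerEdge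
    rw [h1, h2, Set.ncard_union_eq, Set.ncard_image_of_injective _ Sum.inl_injective,
      Set.ncard_image_of_injective _ Sum.inr_injective,
      Set.ncard_image_of_injective _ (Prod.mk_right_injective _), Set.ncard_pair hab,
      Set.ncard_univ, Nat.card_fin]
    · omega
    · rw [Set.disjoint_left]
      rintro _ ⟨x, _, rfl⟩ ⟨y, _, hy⟩
      cases hy

/-- The `k`-th power hypergraph `G^k` of `G`. -/
def powerHypergraph (G : SimpleGraph V) (k : ℕ) (hk : 2 ≤ k) :
    UniformHypergraph (G.PowerVertex k) k where
  vertexSet := Set.univ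
  edgeSet := Set.range (G.powerEdge k)
  subset_vertexSet_of_mem_edgeSet' := fun _ _ => Set.subset_univ _
  vertexSet_eq_univ := rfl
  ncard_eq_of_mem_edgeSet := by
    rintro _ ⟨e, rfl⟩
    exact G.ncard_powerEdge k hk e

end SimpleGraph

/-! For even `k` the eigenvalue equation of `Q` is the critical point equation of `Q x^k / ∑ x_i^k`.
A maximum exists by compactness and is the largest H-eigenvalue
(`signlessLaplacianTensor_isGreatest`). If `k ≥ 4`, each edge of `G^k` has a private vertex.
Negating one such coordinate per edge turns `L` into `Q`, so the spectra agree.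

For monotonicity, write `k = 2n + 2` and fix `μ > 1` and the values of `x` on `V`. In `Q x^k - μ ∑
x_w^k` the new vertices of different edges do not interact. If `P` is the product of `x` over the
two ends of an edge, AM-GM gives the exact maximum `2|P|^(n+1) / (μ-1)^n` of that edge's
contribution. Substituting `z_v = |x_v|^(n+1)` leaves the comparison of `∑ (μ - d_v) z_v^2` with `2
∑_{uv ∈ E} z_u z_v / (μ-1)^n`, where `k` survives only in the exponent `n`. Take `μ = λ(Q(G^l))` and
the `z` of its maximizer. Since `μ > Δ ≥ 2`, the left side is positive and `μ - 1 > 1`, so passing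
to a smaller exponent strictly enlarges the right side. The same `z` then shows `λ(Q(G^k)) > μ` for
`k < l`. -/

/-- The functions `Fin m → W` with image `s` are the `m!` enumerations of `s`. -/
theorem Finset.card_filter_image_univ_eq {W : Type*} [DecidableEq W] [Fintype W] {m : ℕ}
    (s : Finset W) (hs : s.card = m) :
    (Finset.univ.filter fun j : Fin m → W => Finset.univ.image j = s).card = m ! := by
  have hcard : Fintype.card (Fin m ≃ s) = m ! := by
    rw [Fintype.card_equiv (Fintype.equivOfCardEq (by simp [hs])), Fintype.card_fin]
  rw [← hcard, ← Finset.card_univ]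
  symm
  refine Finset.card_bij (fun σ _ t => (σ t : W)) ?_ ?_ ?_
  · intro σ _
    simp only [Finset.mem_filter, Finset.mem_univ, true_and]
    ext w
    simp only [Finset.mem_image, Finset.mem_univ, true_and]
    constructor
    · rintro ⟨t, rfl⟩
      exact (σ t).2
    · intro hw
      exact ⟨σ.symm ⟨w, hw⟩, by simp⟩
  · intro σ _ τ _ h
    ext t
    exact congrFun h t
  · intro j hj
    simp only [Finset.mem_filter, Finset.mem_univ, true_and] at hj
    have hmem : ∀ t, j t ∈ s := fun t => hj ▸ Finset.mem_image_of_mem j (Finset.mem_univ t)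
    have hinj : Function.Injective j := by
      have : (Finset.univ.image j).card = (Finset.univ : Finset (Fin m)).card := by
        rw [hj, hs, Finset.card_univ, Fintype.card_fin]
      simpa using Finset.card_image_iff.mp this
    have hinj' : Function.Injective fun t => (⟨j t, hmem t⟩ : s) :=
      fun a b h => hinj (congrArg Subtype.val h)
    exact ⟨Equiv.ofBijective _
      ((Fintype.bijective_iff_injective_and_card _).mpr ⟨hinj', by simp [hs]⟩),
      Finset.mem_univ _, rfl⟩

theorem Finset.sum_prod_of_image_univ_eq {W : Type*} [DecidableEq W] [Fintype W] {m : ℕ}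
    (s : Finset W) (hs : s.card = m) (x : W → ℝ) :
    (∑ j : Fin m → W, if Finset.univ.image j = s then ∏ t, x (j t) else 0) =
      (m ! : ℝ) * ∏ w ∈ s, x w := by
  have h : ∀ j ∈ Finset.univ.filter fun j : Fin m → W => Finset.univ.image j = s,
      ∏ t, x (j t) = ∏ w ∈ s, x w := by
    intro j hj
    simp only [Finset.mem_filter, Finset.mem_univ, true_and] at hj
    have hinj : Set.InjOn j (Finset.univ : Finset (Fin m)) := by
      rw [← Finset.card_image_iff, hj, hs, Finset.card_univ, Fintype.card_fin]
    rw [← hj, Finset.prod_image hinj]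
  rw [← Finset.sum_filter, Finset.sum_congr rfl h, Finset.sum_const,
    Finset.card_filter_image_univ_eq s hs, nsmul_eq_mul]

/-! ### Tensors of a uniform hypergraph as sums over edges. -/

namespace UniformHypergraph

variable {k : ℕ} {W : Type*} [Fintype W]

open Classical in
/-- The edges of a uniform hypergraph on a finite type, as a finset of finsets. -/
noncomputable def edgeFinset (H : UniformHypergraph W k) : Finset (Finset W) :=
  Finset.univ.filter fun e => (e : Set W) ∈ H.edgeSet

theorem mem_edgeFinset {H : UniformHypergraph W k} {e : Finset W} :
    e ∈ H.edgeFinset ↔ (e : Set W) ∈ H.edgeSet := by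
  simp [edgeFinset]

theorem card_of_mem_edgeFinset {H : UniformHypergraph W k} {e : Finset W}
    (he : e ∈ H.edgeFinset) : e.card = k := by
  have := H.ncard_eq_of_mem_edgeSet _ (mem_edgeFinset.mp he)
  rwa [Set.ncard_coe_finset] at this

theorem apply_degreeTensor (H : UniformHypergraph W k) (x : W → ℝ) (i : W) :
    H.degreeTensor.apply x i = H.degree i * x i ^ (k - 1) := by
  classical
  unfold HTensor.apply degreeTensor
  rw [Finset.sum_eq_single (fun _ => i)]
  · simp
  · intro j _ hj
    rw [if_neg fun h => hj (funext h), zero_mul]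
  · simp

/-- The factor `1 / (k-1)!` cancels the `(k-1)!` orderings of the remaining vertices of each edge.
-/
theorem apply_adjacencyTensor [DecidableEq W] (H : UniformHypergraph W k) (x : W → ℝ) (i : W) :
    H.adjacencyTensor.apply x i =
      ∑ e ∈ H.edgeFinset with i ∈ e, ∏ w ∈ e.erase i, x w := by
  classical
  have key : ∀ j : Fin (k - 1) → W, H.adjacencyTensor i j * ∏ t, x (j t) =
      ∑ e ∈ H.edgeFinset with i ∈ e,
        1 / ((k - 1)! : ℝ) * if Finset.univ.image j = e.erase i then ∏ t, x (j t) else 0 := by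
    intro j
    have hcoe : insert i (Set.range j) =
        ((insert i (Finset.univ.image j) : Finset W) : Set W) := by simp
    have himg : ∀ e ∈ H.edgeFinset, i ∈ e →
        (Finset.univ.image j = e.erase i ↔ insert i (Finset.univ.image j) = e) := by
      intro e he hi
      constructor
      · intro h
        rw [h, Finset.insert_erase hi]
      · intro h
        -- Otherwise the `k - 1` entries of `j` would already cover an edge of size `k`.
        have hni : i ∉ Finset.univ.image j := by
          intro hmem
          rw [Finset.insert_eq_of_mem hmem] at h
          have h1 := Finset.card_image_le (s := (Finset.univ : Finset (Fin (k - 1)))) (f := j)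
          rw [h, card_of_mem_edgeFinset he, Finset.card_univ, Fintype.card_fin] at h1
          have h2 := Finset.card_pos.mpr ⟨i, hi⟩
          rw [card_of_mem_edgeFinset he] at h2
          omega
        rw [← h, Finset.erase_insert hni]
    unfold adjacencyTensor
    rw [hcoe, ← Finset.mul_sum]
    by_cases h : insert i (Finset.univ.image j) ∈ H.edgeFinset
    · rw [if_pos (mem_edgeFinset.mp h), Finset.sum_eq_single (insert i (Finset.univ.image j))]
      · rw [if_pos ((himg _ h (Finset.mem_insert_self _ _)).mpr rfl)]
      · intro e he hne
        rw [Finset.mem_filter] at he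
        rw [if_neg fun h' => hne ((himg e he.1 he.2).mp h').symm]
      · intro h'
        simp [h] at h'
    · rw [if_neg fun h' => h (mem_edgeFinset.mpr h'), zero_mul, Finset.sum_eq_zero, mul_zero]
      intro e he
      rw [Finset.mem_filter] at he
      refine if_neg fun h' => h ?_
      rw [(himg e he.1 he.2).mp h']
      exact he.1
  unfold HTensor.apply
  rw [Finset.sum_congr rfl fun j _ => key j, Finset.sum_comm]
  refine Finset.sum_congr rfl fun e he => ?_
  rw [Finset.mem_filter] at he
  rw [← Finset.mul_sum, Finset.sum_prod_of_image_univ_eq _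
    (by rw [Finset.card_erase_of_mem he.2, card_of_mem_edgeFinset he.1])]
  have : ((k - 1)! : ℝ) ≠ 0 := by positivity
  field_simp

theorem apply_signlessLaplacianTensor [DecidableEq W] (H : UniformHypergraph W k) (x : W → ℝ) (i : W) :
    H.signlessLaplacianTensor.apply x i = H.degree i * x i ^ (k - 1) +
      ∑ e ∈ H.edgeFinset with i ∈ e, ∏ w ∈ e.erase i, x w := by
  rw [← apply_degreeTensor, ← apply_adjacencyTensor]
  simp [HTensor.apply, signlessLaplacianTensor, add_mul, Finset.sum_add_distrib]

theorem apply_laplacianTensor [DecidableEq W] (H : UniformHypergraph W k) (x : W → ℝ) (i : W) :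
    H.laplacianTensor.apply x i = H.degree i * x i ^ (k - 1) -
      ∑ e ∈ H.edgeFinset with i ∈ e, ∏ w ∈ e.erase i, x w := by
  rw [← apply_degreeTensor, ← apply_adjacencyTensor]
  simp [HTensor.apply, laplacianTensor, sub_mul, Finset.sum_sub_distrib]

/-- If the vertices carry signs with product `-1` on every edge, then the Laplacian and the signless
Laplacian tensor have the same H-spectrum. -/
theorem hSpec_laplacianTensor_eq [DecidableEq W] (H : UniformHypergraph W k) (hk : Even k) (hk0 : k ≠ 0)
    (s : W → ℝ) (hs : ∀ w, s w * s w = 1) (hprod : ∀ e ∈ H.edgeFinset, ∏ w ∈ e, s w = -1) :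
    H.laplacianTensor.hSpec = H.signlessLaplacianTensor.hSpec := by
  have hodd : Odd (k - 1) := Nat.Even.sub_odd (by omega) hk odd_one
  have hpow : ∀ w, s w ^ (k - 1) = s w := by
    intro w
    obtain ⟨m, hm⟩ := hodd
    rw [hm, pow_succ, pow_mul, pow_two, hs, one_pow, one_mul]
  have hne : ∀ x : W → ℝ, x ≠ 0 → s * x ≠ 0 := by
    intro x hx h
    refine hx (funext fun w => ?_)
    have := congrFun h w
    simp only [Pi.mul_apply, Pi.zero_apply, mul_eq_zero] at this
    rcases this with h0 | h0
    · have := hs w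
      simp [h0] at this
    · exact h0
  have herase : ∀ (x : W → ℝ) (i : W),
      ∑ e ∈ H.edgeFinset with i ∈ e, ∏ w ∈ e.erase i, (s * x) w =
        -(s i * ∑ e ∈ H.edgeFinset with i ∈ e, ∏ w ∈ e.erase i, x w) := by
    intro x i
    rw [Finset.mul_sum, ← Finset.sum_neg_distrib]
    refine Finset.sum_congr rfl fun e he => ?_
    rw [Finset.mem_filter] at he
    have h1 : s i * ∏ w ∈ e.erase i, s w = -1 := by
      rw [Finset.mul_prod_erase _ _ he.2, hprod e he.1]
    have h2 : ∏ w ∈ e.erase i, s w = -s i := by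
      calc ∏ w ∈ e.erase i, s w = s i * s i * ∏ w ∈ e.erase i, s w := by rw [hs, one_mul]
        _ = -s i := by rw [mul_assoc, h1, mul_neg_one]
    simp only [Pi.mul_apply]
    rw [Finset.prod_mul_distrib, h2, neg_mul]
  ext μ
  constructor
  · rintro ⟨x, hx, h⟩
    refine ⟨s * x, hne x hx, fun i => ?_⟩
    have := h i
    rw [apply_laplacianTensor] at this
    rw [apply_signlessLaplacianTensor, herase, Pi.mul_apply, mul_pow, hpow]
    linear_combination s i * this
  · rintro ⟨x, hx, h⟩
    refine ⟨s * x, hne x hx, fun i => ?_⟩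
    have := h i
    rw [apply_signlessLaplacianTensor] at this
    rw [apply_laplacianTensor, herase, Pi.mul_apply, mul_pow, hpow]
    linear_combination s i * this

/-! ### Variational characterization of the largest H-eigenvalue. -/

/-- The homogeneous form `x ↦ Q x^k` of the signless Laplacian tensor `Q`. -/
noncomputable def signlessForm (H : UniformHypergraph W k) (x : W → ℝ) : ℝ :=
  ∑ i, H.degree i * x i ^ k + k * ∑ e ∈ H.edgeFinset, ∏ w ∈ e, x w

theorem sum_mul_apply_signlessLaplacianTensor [DecidableEq W] (H : UniformHypergraph W k) (hk : k ≠ 0)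
    (x : W → ℝ) :
    ∑ i, x i * H.signlessLaplacianTensor.apply x i = H.signlessForm x := by
  simp only [apply_signlessLaplacianTensor, mul_add, Finset.sum_add_distrib, signlessForm]
  congr 1
  · refine Finset.sum_congr rfl fun i _ => ?_
    rw [mul_left_comm, mul_pow_sub_one hk]
  · simp only [Finset.mul_sum, Finset.sum_filter]
    rw [Finset.sum_comm]
    refine Finset.sum_congr rfl fun e he => ?_
    simp only [mul_ite, mul_zero]
    rw [← Finset.sum_filter, Finset.filter_mem_eq_inter, Finset.univ_inter,
      Finset.sum_congr rfl fun i hi => Finset.mul_prod_erase e x hi, Finset.sum_const,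
      card_of_mem_edgeFinset he, nsmul_eq_mul]

theorem signlessForm_smul (H : UniformHypergraph W k) (c : ℝ) (x : W → ℝ) :
    H.signlessForm (c • x) = c ^ k * H.signlessForm x := by
  unfold signlessForm
  rw [mul_add, mul_left_comm]
  simp only [Finset.mul_sum]
  congr 1
  · refine Finset.sum_congr rfl fun i _ => ?_
    simp only [Pi.smul_apply, smul_eq_mul]
    ring
  · refine Finset.sum_congr rfl fun e he => ?_
    simp only [Pi.smul_apply, smul_eq_mul]
    rw [Finset.prod_mul_distrib, Finset.prod_const, card_of_mem_edgeFinset he]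

theorem continuous_signlessForm (H : UniformHypergraph W k) : Continuous H.signlessForm := by
  unfold signlessForm
  fun_prop

theorem sum_pow_pos {x : W → ℝ} (hk : Even k) (hx : x ≠ 0) : 0 < ∑ i, x i ^ k := by
  obtain ⟨i, hi⟩ := Function.ne_iff.mp hx
  exact Finset.sum_pos' (fun j _ => hk.pow_nonneg _) ⟨i, Finset.mem_univ i, hk.pow_pos hi⟩

/-- The quotient is continuous on the compact unit sphere, and homogeneous of degree 0, so its
maximum there is global. -/
theorem exists_max_signlessForm [Nonempty W] (H : UniformHypergraph W k) (hk : Even k) :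
    ∃ (μ : ℝ) (x : W → ℝ), x ≠ 0 ∧ H.signlessForm x = μ * ∑ i, x i ^ k ∧
      ∀ y, H.signlessForm y ≤ μ * ∑ i, y i ^ k ∨ y = 0 := by
  have hsph : ∀ x ∈ Metric.sphere (0 : W → ℝ) 1, x ≠ 0 := by
    rintro x hx rfl
    simp at hx
  obtain ⟨x, hx, hmax⟩ := (isCompact_sphere (0 : W → ℝ) 1).exists_isMaxOn
    (NormedSpace.sphere_nonempty.mpr zero_le_one)
    (f := fun x => H.signlessForm x / ∑ i, x i ^ k)
    (H.continuous_signlessForm.continuousOn.div (by fun_prop)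
      fun x hx => (sum_pow_pos hk (hsph x hx)).ne')
  refine ⟨_, x, hsph x hx, (div_mul_cancel₀ _ (sum_pow_pos hk (hsph x hx)).ne').symm, fun y => ?_⟩
  by_cases hy : y = 0
  · exact Or.inr hy
  left
  have hn : ‖y‖ ≠ 0 := norm_ne_zero_iff.mpr hy
  have hu : ‖y‖⁻¹ • y ∈ Metric.sphere (0 : W → ℝ) 1 := by
    simp [norm_smul, hn]
  have h := hmax hu
  simp only [Set.mem_ofPred_eq] at h
  rw [div_le_iff₀ (sum_pow_pos hk (hsph _ hu)), signlessForm_smul] at h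
  have hsum : ∑ i, (‖y‖⁻¹ • y) i ^ k = ‖y‖⁻¹ ^ k * ∑ i, y i ^ k := by
    simp [Finset.mul_sum, mul_pow]
  rw [hsum, mul_left_comm] at h
  exact le_of_mul_le_mul_left h (by positivity)

/-- A maximizer of the form is an eigenvector. -/
theorem apply_eq_of_max_signlessForm [DecidableEq W] (H : UniformHypergraph W k) (hk0 : k ≠ 0) {μ : ℝ} {x : W → ℝ}
    (hx : H.signlessForm x = μ * ∑ i, x i ^ k)
    (hmax : ∀ y, H.signlessForm y ≤ μ * ∑ i, y i ^ k) (i : W) :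
    H.signlessLaplacianTensor.apply x i = μ * x i ^ (k - 1) := by
  set B : ℝ := ∑ e ∈ H.edgeFinset with i ∈ e, ∏ w ∈ e.erase i, x w with hB
  -- As a function of the coordinate at `i` alone, the form is a `k`-th power term, a linear term
  -- and a constant, because an edge contains `i` at most once. The vanishing derivative at `x i` is
  -- `k` times the eigenvalue equation at `i`.
  obtain ⟨C, hC⟩ : ∃ C : ℝ, ∀ s : ℝ, H.signlessForm (Function.update x i s) -
      μ * ∑ w, Function.update x i s w ^ k = (H.degree i - μ) * s ^ k + k * B * s + C := by
    have hoff : ∀ (s : ℝ) (t : Finset W), i ∉ t →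
        ∏ w ∈ t, Function.update x i s w = ∏ w ∈ t, x w := fun s t ht =>
      Finset.prod_congr rfl fun w hw =>
        Function.update_of_ne (fun h : w = i => ht (h ▸ hw)) _ _
    refine ⟨∑ w ∈ Finset.univ.erase i, (H.degree w - μ) * x w ^ k +
      k * ∑ e ∈ H.edgeFinset with i ∉ e, ∏ w ∈ e, x w, fun s => ?_⟩
    have h1 : ∑ w, (H.degree w - μ) * Function.update x i s w ^ k =
        (H.degree i - μ) * s ^ k + ∑ w ∈ Finset.univ.erase i, (H.degree w - μ) * x w ^ k := by
      rw [← Finset.add_sum_erase _ _ (Finset.mem_univ i), Function.update_self]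
      congr 1
      refine Finset.sum_congr rfl fun w hw => ?_
      rw [Function.update_of_ne (Finset.ne_of_mem_erase hw)]
    have h2 : ∑ e ∈ H.edgeFinset, ∏ w ∈ e, Function.update x i s w =
        B * s + ∑ e ∈ H.edgeFinset with i ∉ e, ∏ w ∈ e, x w := by
      rw [← Finset.sum_filter_add_sum_filter_not H.edgeFinset fun e => i ∈ e, hB, Finset.sum_mul]
      congr 1
      · refine Finset.sum_congr rfl fun e he => ?_
        rw [← Finset.mul_prod_erase _ _ (Finset.mem_filter.mp he).2, Function.update_self,
          hoff s _ (Finset.notMem_erase i e), mul_comm]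
      · exact Finset.sum_congr rfl fun e he => hoff s e (Finset.mem_filter.mp he).2
    rw [signlessForm, h2]
    have h3 : ∑ w, (H.degree w - μ) * Function.update x i s w ^ k =
        ∑ w, H.degree w * Function.update x i s w ^ k -
          μ * ∑ w, Function.update x i s w ^ k := by
      simp [sub_mul, Finset.sum_sub_distrib, Finset.mul_sum]
    rw [h1] at h3
    linear_combination -h3
  have hloc : IsLocalMax (fun s : ℝ => (H.degree i - μ) * s ^ k + k * B * s + C) (x i) := by
    refine Filter.Eventually.of_forall fun s => ?_
    simp only
    rw [← hC, ← hC, Function.update_eq_self]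
    linarith [hmax (Function.update x i s)]
  have hder : HasDerivAt (fun s : ℝ => (H.degree i - μ) * s ^ k + k * B * s + C)
      ((H.degree i - μ) * (k * x i ^ (k - 1)) + k * B * 1) (x i) :=
    (((hasDerivAt_pow k (x i)).const_mul _).add ((hasDerivAt_id (x i)).const_mul _)).add_const _
  have h0 := hloc.hasDerivAt_eq_zero hder
  have hk' : (k : ℝ) ≠ 0 := Nat.cast_ne_zero.mpr hk0
  rw [apply_signlessLaplacianTensor, ← hB]
  refine mul_left_cancel₀ hk' ?_
  linear_combination h0

/-- For even order the largest H-eigenvalue of the signless Laplacian tensor exists, and it is the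
maximum of `Q x^k / ∑ x_i^k`. -/
theorem signlessLaplacianTensor_isGreatest [Nonempty W] (H : UniformHypergraph W k)
    (hk : Even k) (hk0 : k ≠ 0) :
    IsGreatest H.signlessLaplacianTensor.hSpec H.signlessLaplacianTensor.largestHEigenvalue ∧
    (∀ y, H.signlessForm y ≤ H.signlessLaplacianTensor.largestHEigenvalue * ∑ i, y i ^ k) ∧
    ∃ x, x ≠ 0 ∧
      H.signlessForm x = H.signlessLaplacianTensor.largestHEigenvalue * ∑ i, x i ^ k := by
  classical
  obtain ⟨μ, x, hx0, hx, hmax'⟩ := H.exists_max_signlessForm hk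
  have hmax : ∀ y, H.signlessForm y ≤ μ * ∑ i, y i ^ k := by
    intro y
    rcases hmax' y with h | rfl
    · exact h
    · have := H.signlessForm_smul 0 0
      rw [zero_pow hk0, zero_mul, smul_zero] at this
      simp [this, hk0]
  have hgr : IsGreatest H.signlessLaplacianTensor.hSpec μ := by
    refine ⟨⟨x, hx0, H.apply_eq_of_max_signlessForm hk0 hx hmax⟩, ?_⟩
    rintro ν ⟨y, hy0, hy⟩
    -- Pairing the eigenvalue equation with `y` turns the form at `y` into `ν ∑ y_i^k`.
    have h := hmax y
    rw [← H.sum_mul_apply_signlessLaplacianTensor hk0, Finset.sum_congr rfl fun i _ => by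
      rw [hy i, mul_left_comm, mul_pow_sub_one hk0], ← Finset.mul_sum] at h
    exact le_of_mul_le_mul_right h (sum_pow_pos hk hy0)
  have hμ : H.signlessLaplacianTensor.largestHEigenvalue = μ := hgr.csSup_eq
  rw [hμ]
  exact ⟨hgr, hmax, x, hx0, hx⟩

end UniformHypergraph

/-! ### Optimizing over the new vertices of one edge. -/

/-- The inequality of arithmetic and geometric means for `k`-th powers of `k` nonnegative reals. -/
theorem card_mul_prod_le_sum_pow {ι : Type*} [Fintype ι] [Nonempty ι] (a : ι → ℝ)
    (ha : ∀ i, 0 ≤ a i) :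
    (Fintype.card ι : ℝ) * ∏ i, a i ≤ ∑ i, a i ^ Fintype.card ι := by
  have hn : Fintype.card ι ≠ 0 := Fintype.card_ne_zero
  have hn' : (0 : ℝ) < Fintype.card ι := by exact_mod_cast Fintype.card_pos
  have h := Real.geom_mean_le_arith_mean_weighted Finset.univ
    (fun _ : ι => (Fintype.card ι : ℝ)⁻¹) (fun i => a i ^ Fintype.card ι)
    (fun i _ => by positivity) (by simp [Finset.sum_const, hn'.ne'])
    (fun i _ => pow_nonneg (ha i) _)
  simp only [fun i => Real.pow_rpow_inv_natCast (ha i) hn] at h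
  rw [← Finset.mul_sum] at h
  rwa [le_inv_mul_iff₀ hn'] at h

/-- AM-GM for `2n + 2` numbers: the `γ|y_i|` with `γ^(2n+2) = c`, and two copies of a `q` chosen so
that the product of all of them is `|P ∏ y_i|`. -/
theorem mul_mul_prod_sub_le {n : ℕ} {c : ℝ} (hc : 0 < c) (P : ℝ) (y : Fin (2 * n) → ℝ) :
    ((2 * n + 2 : ℕ) : ℝ) * P * ∏ i, y i - c * ∑ i, y i ^ (2 * n + 2) ≤
      2 * |P| ^ (n + 1) / c ^ n := by
  obtain ⟨γ, hγ, hγc⟩ : ∃ γ : ℝ, 0 < γ ∧ γ ^ (2 * n + 2) = c :=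
    ⟨c ^ (((2 * n + 2 : ℕ) : ℝ)⁻¹), by positivity, Real.rpow_inv_natCast_pow hc.le (by omega)⟩
  set q := √|P| / γ ^ n with hq
  have hs : √|P| ^ 2 = |P| := Real.sq_sqrt (abs_nonneg P)
  have h := card_mul_prod_le_sum_pow (ι := Fin 2 ⊕ Fin (2 * n))
    (Sum.elim (fun _ => q) fun i => γ * |y i|)
    (by rintro (i | i) <;> simp only [Sum.elim_inl, Sum.elim_inr] <;> positivity)
  have hcard : Fintype.card (Fin 2 ⊕ Fin (2 * n)) = 2 * n + 2 := by simp [add_comm]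
  rw [hcard, Fintype.prod_sum_type, Fintype.sum_sum_type] at h
  simp only [Sum.elim_inl, Sum.elim_inr, Finset.prod_const, Finset.sum_const, Finset.card_univ,
    Fintype.card_fin, Finset.prod_mul_distrib, mul_pow, nsmul_eq_mul, hγc] at h
  rw [← Finset.mul_sum, ← Finset.abs_prod] at h
  have hq2 : q ^ 2 * (γ ^ (2 * n) * |∏ i, y i|) = |P * ∏ i, y i| := by
    rw [hq, div_pow, hs, abs_mul, ← pow_mul, mul_comm n 2]
    field_simp
  have hqk : q ^ (2 * n + 2) = |P| ^ (n + 1) / c ^ n := by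
    rw [hq, div_pow, ← hγc, ← pow_mul, ← pow_mul, show 2 * n + 2 = 2 * (n + 1) by ring, pow_mul, hs]
    congr 2
    ring
  have heven : ∀ i, |y i| ^ (2 * n + 2) = y i ^ (2 * n + 2) := fun i =>
    Even.pow_abs ⟨n + 1, by ring⟩ _
  simp only [heven] at h
  rw [hq2, hqk] at h
  have h1 : ((2 * n + 2 : ℕ) : ℝ) * (P * ∏ i, y i) ≤
      ((2 * n + 2 : ℕ) : ℝ) * |P * ∏ i, y i| :=
    mul_le_mul_of_nonneg_left (le_abs_self _) (Nat.cast_nonneg _)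
  have h2 : 2 * |P| ^ (n + 1) / c ^ n = ((2 : ℕ) : ℝ) * (|P| ^ (n + 1) / c ^ n) := by
    push_cast
    ring
  rw [h2]
  linarith

/-- For `P ≥ 0`, the bound of `mul_mul_prod_sub_le` is attained when all `y_i` equal `√(P / c)`. -/
theorem mul_mul_sqrt_pow_sub {n : ℕ} {c P : ℝ} (hc : 0 < c) (hP : 0 ≤ P) :
    ((2 * n + 2 : ℕ) : ℝ) * P * √(P / c) ^ (2 * n) -
      c * ((2 * n : ℕ) * √(P / c) ^ (2 * n + 2)) = 2 * P ^ (n + 1) / c ^ n := by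
  have hs : √(P / c) ^ 2 = P / c := Real.sq_sqrt (by positivity)
  rw [show 2 * n + 2 = 2 * (n + 1) by ring, pow_mul, pow_mul, hs, div_pow, div_pow]
  push_cast
  field_simp
  ring

/-! ### Degrees, edges and the form of a power hypergraph. -/

namespace SimpleGraph

variable {V : Type*}

theorem powerEdge_injective (G : SimpleGraph V) (k : ℕ) : Function.Injective (G.powerEdge k) := by
  intro e f h
  refine Subtype.ext (Sym2.ext fun v => ?_)
  have := Set.ext_iff.mp h (Sum.inl v)
  simpa [powerEdge] using this

theorem degree_powerHypergraph_inl [Fintype V] (G : SimpleGraph V) [DecidableRel G.Adj] (k : ℕ)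
    (hk : 2 ≤ k) (v : V) : (G.powerHypergraph k hk).degree (Sum.inl v) = G.degree v := by
  classical
  have h1 : {s | s ∈ (G.powerHypergraph k hk).edgeSet ∧ Sum.inl v ∈ s} =
      G.powerEdge k '' {e | v ∈ (e : Sym2 V)} := by
    ext s
    simp only [Set.mem_ofPred_eq, powerHypergraph, Set.mem_range, Set.mem_image]
    constructor
    · rintro ⟨⟨e, rfl⟩, h⟩
      exact ⟨e, by simpa [powerEdge] using h, rfl⟩
    · rintro ⟨e, h, rfl⟩
      exact ⟨⟨e, rfl⟩, by simpa [powerEdge] using h⟩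
  have h2 : Subtype.val '' {e : G.edgeSet | v ∈ (e : Sym2 V)} = G.incidenceSet v := by
    ext e
    simp [incidenceSet, and_comm]
  rw [UniformHypergraph.degree, h1, Set.ncard_image_of_injective _ (G.powerEdge_injective k),
    ← Set.ncard_image_of_injective _ Subtype.val_injective, h2, Set.ncard_eq_toFinset_card',
    Set.toFinset_card, G.card_incidenceSet_eq_degree]

theorem degree_powerHypergraph_inr (G : SimpleGraph V) (k : ℕ) (hk : 2 ≤ k)
    (p : G.edgeSet × Fin (k - 2)) : (G.powerHypergraph k hk).degree (Sum.inr p) = 1 := by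
  rw [UniformHypergraph.degree, Set.ncard_eq_one]
  refine ⟨G.powerEdge k p.1, ?_⟩
  ext s
  simp only [Set.mem_ofPred_eq, powerHypergraph, Set.mem_range, Set.mem_singleton_iff]
  constructor
  · rintro ⟨⟨e, rfl⟩, h⟩
    rw [show p.1 = e by simpa [powerEdge] using h]
  · rintro rfl
    exact ⟨⟨_, rfl⟩, by simp [powerEdge]⟩

variable [DecidableEq V] (G : SimpleGraph V)

/-- The finset version of `SimpleGraph.powerEdge`. -/
def powerEdgeFinset (k : ℕ) (e : G.edgeSet) : Finset (G.PowerVertex k) :=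
  (e : Sym2 V).toFinset.disjSum ({e} ×ˢ Finset.univ)

theorem coe_powerEdgeFinset (k : ℕ) (e : G.edgeSet) :
    (G.powerEdgeFinset k e : Set (G.PowerVertex k)) = G.powerEdge k e := by
  ext (v | p)
  · simp [powerEdgeFinset, powerEdge]
  · simp [powerEdgeFinset, powerEdge, Prod.ext_iff, eq_comm]

theorem powerEdgeFinset_injective (k : ℕ) : Function.Injective (G.powerEdgeFinset k) := by
  intro e f h
  apply G.powerEdge_injective k
  rw [← coe_powerEdgeFinset, h, coe_powerEdgeFinset]

theorem prod_powerEdgeFinset (k : ℕ) (e : G.edgeSet) (x : G.PowerVertex k → ℝ) :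
    ∏ w ∈ G.powerEdgeFinset k e, x w =
      (∏ v ∈ (e : Sym2 V).toFinset, x (Sum.inl v)) * ∏ i, x (Sum.inr (e, i)) := by
  rw [powerEdgeFinset, Finset.prod_disjSum, Finset.prod_product, Finset.prod_singleton]

variable [Fintype V] [Fintype G.edgeSet]

theorem edgeFinset_powerHypergraph [DecidableEq G.edgeSet] (k : ℕ) (hk : 2 ≤ k) :
    (G.powerHypergraph k hk).edgeFinset = Finset.univ.image (G.powerEdgeFinset k) := by
  ext s
  simp only [UniformHypergraph.mem_edgeFinset, powerHypergraph, Set.mem_range, Finset.mem_image,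
    Finset.mem_univ, true_and, ← coe_powerEdgeFinset, Finset.coe_inj]

/-- New vertices have degree 1 and lie in a single edge, so for fixed values on `V` the edges
decouple. -/
theorem signlessForm_powerHypergraph [DecidableRel G.Adj] (k : ℕ) (hk : 2 ≤ k) (μ : ℝ)
    (x : G.PowerVertex k → ℝ) :
    (G.powerHypergraph k hk).signlessForm x - μ * ∑ w, x w ^ k =
      ∑ e : G.edgeSet, (k * (∏ v ∈ (e : Sym2 V).toFinset, x (Sum.inl v)) *
        ∏ i, x (Sum.inr (e, i)) - (μ - 1) * ∑ i, x (Sum.inr (e, i)) ^ k) -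
      ∑ v, (μ - G.degree v) * x (Sum.inl v) ^ k := by
  classical
  rw [UniformHypergraph.signlessForm, edgeFinset_powerHypergraph,
    Finset.sum_image fun _ _ _ _ h => G.powerEdgeFinset_injective k h]
  simp only [prod_powerEdgeFinset, Fintype.sum_sum_type, degree_powerHypergraph_inl,
    degree_powerHypergraph_inr, Fintype.sum_prod_type, sub_mul, Finset.sum_sub_distrib,
    ← Finset.mul_sum, mul_assoc]
  push_cast
  ring

/-- For `k ≥ 4` every edge has a vertex of its own, whose sign may be flipped. -/
theorem hSpec_laplacianTensor_powerHypergraph (k : ℕ) (hk : 2 ≤ k) (hk4 : 4 ≤ k) (hke : Even k) :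
    (G.powerHypergraph k hk).laplacianTensor.hSpec =
      (G.powerHypergraph k hk).signlessLaplacianTensor.hSpec := by
  classical
  set i₀ : Fin (k - 2) := ⟨0, by omega⟩
  -- Exactly one vertex of each edge, its first new one, gets the sign `-1`.
  refine UniformHypergraph.hSpec_laplacianTensor_eq _ hke (by omega)
    (Sum.elim (fun _ => 1) fun p => if p.2 = i₀ then -1 else 1) ?_ ?_
  · rintro (v | p)
    · simp
    · simp only [Sum.elim_inr]
      split_ifs <;> norm_num
  · intro e he
    rw [edgeFinset_powerHypergraph, Finset.mem_image] at he
    obtain ⟨e, -, rfl⟩ := he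
    simp [prod_powerEdgeFinset, Finset.prod_ite_eq']

/-! ### Comparison of the largest H-eigenvalues of different powers. -/

theorem maxDegree_lt_largestHEigenvalue [DecidableRel G.Adj] (hΔ : 0 < G.maxDegree) (k : ℕ)
    (hk : 2 ≤ k) (hke : Even k) :
    (G.maxDegree : ℝ) <
      (G.powerHypergraph k hk).signlessLaplacianTensor.largestHEigenvalue := by
  classical
  have : Nonempty V := by
    by_contra h
    rw [not_nonempty_iff] at h
    simp at hΔ
  obtain ⟨v₀, hv₀⟩ := G.exists_maximal_degree_vertex
  obtain ⟨u, hu⟩ := (G.degree_pos_iff_exists_adj v₀).mp (hv₀ ▸ hΔ)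
  let e₀ : G.edgeSet := ⟨s(v₀, u), hu⟩
  obtain ⟨-, hmax, -⟩ := (G.powerHypergraph k hk).signlessLaplacianTensor_isGreatest hke (by omega)
  have hD : (0 : ℝ) < G.maxDegree := by exact_mod_cast hΔ
  set D : ℝ := (G.maxDegree : ℝ)
  -- With `D⁻¹` on the other `k - 1` vertices of one edge at `v₀`, the form is at least `D + k
  -- D^(1-k)`, while `D ∑ x_w^k = D + (k-1) D^(1-k)`.
  let x : G.PowerVertex k → ℝ := fun w =>
    if w = Sum.inl v₀ then 1 else if w ∈ G.powerEdgeFinset k e₀ then D⁻¹ else 0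
  have hx0 : ∀ w, 0 ≤ x w := by
    intro w
    simp only [x]
    split_ifs <;> positivity
  have hmem : Sum.inl v₀ ∈ G.powerEdgeFinset k e₀ := by simp [powerEdgeFinset, e₀]
  have hcard : (G.powerEdgeFinset k e₀).card = k := by
    rw [← Set.ncard_coe_finset, coe_powerEdgeFinset, ncard_powerEdge _ _ hk]
  have hcard' : ((G.powerEdgeFinset k e₀).erase (Sum.inl v₀)).card = k - 1 := by
    rw [Finset.card_erase_of_mem hmem, hcard]
  have hxe : ∀ w ∈ (G.powerEdgeFinset k e₀).erase (Sum.inl v₀), x w = D⁻¹ := by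
    intro w hw
    rw [Finset.mem_erase] at hw
    simp [x, hw.1, hw.2]
  have hxv : x (Sum.inl v₀) = 1 := by simp [x]
  have hk0 : k ≠ 0 := by omega
  have hN : ∑ w, x w ^ k = 1 + (k - 1 : ℕ) * D⁻¹ ^ k := by
    rw [← Finset.sum_subset (Finset.subset_univ (G.powerEdgeFinset k e₀)) (fun w _ hw => ?_),
      ← Finset.add_sum_erase _ _ hmem, hxv, one_pow,
      Finset.sum_congr rfl fun w hw => by rw [hxe w hw], Finset.sum_const, hcard', nsmul_eq_mul]
    have : w ≠ Sum.inl v₀ := fun h => hw (h ▸ hmem)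
    simp [x, this, hw, hk0]
  have hF : D + k * D⁻¹ ^ (k - 1) ≤ (G.powerHypergraph k hk).signlessForm x := by
    unfold UniformHypergraph.signlessForm
    gcongr ?_ + _ * ?_
    · refine le_trans ?_ (Finset.single_le_sum (fun w _ =>
        mul_nonneg (Nat.cast_nonneg _) (pow_nonneg (hx0 w) k)) (Finset.mem_univ (Sum.inl v₀)))
      rw [hxv, degree_powerHypergraph_inl, ← hv₀, one_pow, mul_one]
    · rw [edgeFinset_powerHypergraph]
      refine le_trans ?_ (Finset.single_le_sum (fun e _ => Finset.prod_nonneg fun w _ => hx0 w)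
        (Finset.mem_image_of_mem _ (Finset.mem_univ e₀)))
      rw [← Finset.mul_prod_erase _ _ hmem, hxv, one_mul, Finset.prod_congr rfl hxe,
        Finset.prod_const, hcard']
  by_contra! hle
  have h := (hF.trans (hmax x)).trans (mul_le_mul_of_nonneg_right hle
    (Finset.sum_nonneg fun w _ => pow_nonneg (hx0 w) k))
  have hpow : D * D⁻¹ ^ k = D⁻¹ ^ (k - 1) := by
    rw [← mul_pow_sub_one hk0, ← mul_assoc, mul_inv_cancel₀ hD.ne', one_mul]
  have hpos : 0 < D⁻¹ ^ (k - 1) := by positivity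
  rw [hN, Nat.cast_sub (by omega), mul_add, mul_one, mul_left_comm, hpow] at h
  push_cast at h
  linarith

/-- The maximizer for `G^{2n+2}`, restricted to `V` and renormalized, as a test vector for the
matrix `A - (μ - 1)^n (μ - D)` of `G`. -/
theorem exists_nonneg_of_largestHEigenvalue [DecidableRel G.Adj] (hΔ : 2 ≤ G.maxDegree) (n : ℕ)
    (hn : 2 ≤ 2 * n + 2) :
    let μ := (G.powerHypergraph (2 * n + 2) hn).signlessLaplacianTensor.largestHEigenvalue
    ∃ z : V → ℝ, (∀ v, 0 ≤ z v) ∧ z ≠ 0 ∧ ∑ v, (μ - G.degree v) * z v ^ 2 ≤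
      2 * (∑ e : G.edgeSet, ∏ v ∈ (e : Sym2 V).toFinset, z v) / (μ - 1) ^ n := by
  classical
  intro μ
  have : Nonempty V := by
    by_contra h
    rw [not_nonempty_iff] at h
    simp at hΔ
  have hke : Even (2 * n + 2) := ⟨n + 1, by ring⟩
  obtain ⟨-, -, x, hx0, hx⟩ :=
    (G.powerHypergraph (2 * n + 2) hn).signlessLaplacianTensor_isGreatest hke (by omega)
  have hμ : (2 : ℝ) < μ := lt_of_le_of_lt (by exact_mod_cast hΔ)
    (G.maxDegree_lt_largestHEigenvalue (by omega) (2 * n + 2) hn hke)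
  have hform := G.signlessForm_powerHypergraph (2 * n + 2) hn μ x
  rw [hx, sub_self] at hform
  -- This `z` is nonzero: if `x` vanished on `V`, then `(μ - 1) ∑ x_p^k = 0` over the new vertices
  -- `p`, forcing `x = 0`.
  refine ⟨fun v => |x (Sum.inl v)| ^ (n + 1), fun v => by positivity, fun hz => ?_, ?_⟩
  · have hV : ∀ v, x (Sum.inl v) = 0 := by
      intro v
      have := congrFun hz v
      simpa using this
    have hP : ∀ e : G.edgeSet, ∏ v ∈ (e : Sym2 V).toFinset, x (Sum.inl v) = 0 := by
      rintro ⟨e, he⟩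
      induction e using Sym2.ind with
      | _ a b => exact Finset.prod_eq_zero (i := a) (by simp) (hV a)
    simp only [hP, mul_zero, zero_mul, zero_sub] at hform
    simp only [hV, mul_zero, ne_eq, Nat.add_eq_zero_iff, OfNat.ofNat_ne_zero,
      and_false, not_false_eq_true, zero_pow, Finset.sum_const_zero, sub_zero,
      Finset.sum_neg_distrib, ← Finset.mul_sum] at hform
    have hnn : ∀ p : G.edgeSet × Fin (2 * n + 2 - 2), 0 ≤ x (Sum.inr p) ^ (2 * n + 2) :=
      fun p => hke.pow_nonneg _
    have hsum : ∑ p : G.edgeSet × Fin (2 * n + 2 - 2), x (Sum.inr p) ^ (2 * n + 2) = 0 := by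
      rw [Fintype.sum_prod_type]
      have h1 : μ - 1 ≠ 0 := by linarith
      have h2 := neg_eq_zero.mp hform.symm
      exact (mul_eq_zero.mp h2).resolve_left h1
    rw [Finset.sum_eq_zero_iff_of_nonneg fun p _ => hnn p] at hsum
    apply hx0
    funext w
    rcases w with v | p
    · exact hV v
    · exact pow_eq_zero_iff (by omega) |>.mp (hsum p (Finset.mem_univ p))
  · have hpow : ∀ v, (|x (Sum.inl v)| ^ (n + 1)) ^ 2 = x (Sum.inl v) ^ (2 * n + 2) := by
      intro v
      rw [← pow_mul, show (n + 1) * 2 = 2 * n + 2 by ring, hke.pow_abs]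
    simp only [hpow]
    rw [Finset.mul_sum, Finset.sum_div]
    have hle : ∑ v, (μ - G.degree v) * x (Sum.inl v) ^ (2 * n + 2) =
        ∑ e : G.edgeSet, (((2 * n + 2 : ℕ) : ℝ) * (∏ v ∈ (e : Sym2 V).toFinset, x (Sum.inl v)) *
        ∏ i, x (Sum.inr (e, i)) - (μ - 1) * ∑ i, x (Sum.inr (e, i)) ^ (2 * n + 2)) := by
      linarith
    rw [hle]
    refine Finset.sum_le_sum fun e _ => ?_
    have h := mul_mul_prod_sub_le (n := n) (c := μ - 1) (by linarith)
      (∏ v ∈ (e : Sym2 V).toFinset, x (Sum.inl v)) fun i => x (Sum.inr (e, i))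
    rwa [Finset.abs_prod, ← Finset.prod_pow] at h

/-- Converse direction: the vector with `z_v^(1/(n+1))` on `V` and the AM-GM optimum on the new
vertices has quotient above `μ`. -/
theorem lt_largestHEigenvalue_of_lt_sum [DecidableRel G.Adj] {μ : ℝ} (hμ : 1 < μ) (n : ℕ)
    (hn : 2 ≤ 2 * n + 2) {z : V → ℝ} (hz : ∀ v, 0 ≤ z v)
    (h : ∑ v, (μ - G.degree v) * z v ^ 2 <
      2 * (∑ e : G.edgeSet, ∏ v ∈ (e : Sym2 V).toFinset, z v) / (μ - 1) ^ n) :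
    μ < (G.powerHypergraph (2 * n + 2) hn).signlessLaplacianTensor.largestHEigenvalue := by
  classical
  have hke : Even (2 * n + 2) := ⟨n + 1, by ring⟩
  have : Nonempty V := by
    by_contra hV
    rw [not_nonempty_iff] at hV
    have : IsEmpty G.edgeSet := ⟨fun e => (e : Sym2 V).ind (fun a _ => hV.false a)⟩
    simp at h
  obtain ⟨-, hmax, -⟩ :=
    (G.powerHypergraph (2 * n + 2) hn).signlessLaplacianTensor_isGreatest hke (by omega)
  obtain ⟨a, ha, haz⟩ : ∃ a : V → ℝ, (∀ v, 0 ≤ a v) ∧ ∀ v, a v ^ (n + 1) = z v :=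
    ⟨fun v => z v ^ (((n + 1 : ℕ) : ℝ)⁻¹), fun v => Real.rpow_nonneg (hz v) _,
      fun v => Real.rpow_inv_natCast_pow (hz v) (by omega)⟩
  let P : G.edgeSet → ℝ := fun e => ∏ v ∈ (e : Sym2 V).toFinset, a v
  have hP : ∀ e, 0 ≤ P e := fun e => Finset.prod_nonneg fun v _ => ha v
  let x : G.PowerVertex (2 * n + 2) → ℝ := Sum.elim a fun p => √(P p.1 / (μ - 1))
  have hform := G.signlessForm_powerHypergraph (2 * n + 2) hn μ x
  have hbr : ∀ e : G.edgeSet, ((2 * n + 2 : ℕ) : ℝ) *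
      (∏ v ∈ (e : Sym2 V).toFinset, x (Sum.inl v)) * ∏ i, x (Sum.inr (e, i)) -
        (μ - 1) * ∑ i, x (Sum.inr (e, i)) ^ (2 * n + 2) =
      2 * (∏ v ∈ (e : Sym2 V).toFinset, z v) / (μ - 1) ^ n := by
    intro e
    have h1 := mul_mul_sqrt_pow_sub (n := n) (c := μ - 1) (by linarith) (hP e)
    have h2 : P e ^ (n + 1) = ∏ v ∈ (e : Sym2 V).toFinset, z v := by
      simp only [P, ← Finset.prod_pow, haz]
    rw [h2] at h1
    rw [← h1]
    simp [x, P]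
  have hsq : ∀ v, x (Sum.inl v) ^ (2 * n + 2) = z v ^ 2 := by
    intro v
    rw [← haz, ← pow_mul, show (n + 1) * 2 = 2 * n + 2 by ring]
    rfl
  simp only [hbr, hsq] at hform
  rw [Finset.mul_sum, Finset.sum_div] at h
  have hpos : 0 < (G.powerHypergraph (2 * n + 2) hn).signlessForm x -
      μ * ∑ w, x w ^ (2 * n + 2) := by linarith
  have hNN : 0 ≤ ∑ w, x w ^ (2 * n + 2) := Finset.sum_nonneg fun w _ => hke.pow_nonneg _
  by_contra! hle
  have := mul_le_mul_of_nonneg_right hle hNN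
  linarith [hmax x]

theorem largestHEigenvalue_powerHypergraph_lt [DecidableRel G.Adj] (hΔ : 2 ≤ G.maxDegree)
    (k l : ℕ) (hk : 2 ≤ k) (hl : 2 ≤ l) (hke : Even k) (hle : Even l) (hkl : k < l) :
    (G.powerHypergraph l hl).signlessLaplacianTensor.largestHEigenvalue <
      (G.powerHypergraph k hk).signlessLaplacianTensor.largestHEigenvalue := by
  have hμ := G.maxDegree_lt_largestHEigenvalue (by omega) l hl hle
  obtain ⟨m, rfl⟩ : ∃ m, k = 2 * m + 2 := ⟨k / 2 - 1, by have := hke.two_dvd; omega⟩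
  obtain ⟨n, rfl⟩ : ∃ n, l = 2 * n + 2 := ⟨l / 2 - 1, by have := hle.two_dvd; omega⟩
  obtain ⟨z, hz, hz0, hzle⟩ := G.exists_nonneg_of_largestHEigenvalue hΔ n hl
  set μ := (G.powerHypergraph (2 * n + 2) hl).signlessLaplacianTensor.largestHEigenvalue
  have h2 : (2 : ℝ) < μ := lt_of_le_of_lt (by exact_mod_cast hΔ) hμ
  refine G.lt_largestHEigenvalue_of_lt_sum (by linarith) m hk hz (hzle.trans_lt ?_)
  have hd : ∀ v, 0 < μ - G.degree v := fun v => by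
    have : (G.degree v : ℝ) ≤ G.maxDegree := by exact_mod_cast G.degree_le_maxDegree v
    linarith
  obtain ⟨v, hv⟩ := Function.ne_iff.mp hz0
  -- Positivity here forces the edge sum to be positive, so that lowering the exponent of `μ - 1 >
  -- 1` gives a strict gain.
  have hpos : 0 < ∑ v, (μ - G.degree v) * z v ^ 2 :=
    Finset.sum_pos' (fun v _ => mul_nonneg (hd v).le (sq_nonneg _))
      ⟨v, Finset.mem_univ v, mul_pos (hd v) (pow_pos ((hz v).lt_of_ne' hv) 2)⟩
  have hden : 0 < (μ - 1) ^ n := pow_pos (by linarith) n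
  have hnum := (div_pos_iff_of_pos_right hden).mp (hpos.trans_le hzle)
  exact div_lt_div_of_pos_left hnum (pow_pos (by linarith) m)
    (pow_lt_pow_right₀ (by linarith) (by omega))

end SimpleGraph

theorem theorem3p3 {V : Type*} [Fintype V] (G : SimpleGraph V)
    [DecidableRel G.Adj] (hΔ : 2 ≤ G.maxDegree) :
    -- for even `k ≥ 4` both largest H-eigenvalues exist, and they agree
    (∀ (k : ℕ) (hk : 4 ≤ k), Even k →
      IsGreatest (G.powerHypergraph k (by omega)).laplacianTensor.hSpec
        (G.powerHypergraph k (by omega)).laplacianTensor.largestHEigenvalue ∧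
      (G.powerHypergraph k (by omega)).laplacianTensor.largestHEigenvalue =
        (G.powerHypergraph k (by omega)).signlessLaplacianTensor.largestHEigenvalue) ∧
    -- for even `k ≥ 2` the largest H-eigenvalue of the signless Laplacian tensor exists
    (∀ (k : ℕ) (hk : 2 ≤ k), Even k →
      IsGreatest (G.powerHypergraph k hk).signlessLaplacianTensor.hSpec
        (G.powerHypergraph k hk).signlessLaplacianTensor.largestHEigenvalue) ∧
    -- and it is strictly decreasing in `k`
    (∀ (k l : ℕ) (hk : 2 ≤ k) (hl : 2 ≤ l), Even k → Even l → k < l →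
      (G.powerHypergraph l hl).signlessLaplacianTensor.largestHEigenvalue <
        (G.powerHypergraph k hk).signlessLaplacianTensor.largestHEigenvalue) ∧
    -- for even `k ≥ 4`, so is that of the Laplacian tensor
    (∀ (k l : ℕ) (hk : 4 ≤ k) (hl : 4 ≤ l), Even k → Even l → k < l →
      (G.powerHypergraph l (by omega)).laplacianTensor.largestHEigenvalue <
        (G.powerHypergraph k (by omega)).laplacianTensor.largestHEigenvalue) := by

  classical
  have : Nonempty V := by
    by_contra h
    rw [not_nonempty_iff] at h
    simp at hΔ
  have hQ : ∀ (k : ℕ) (hk : 2 ≤ k), Even k →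
      IsGreatest (G.powerHypergraph k hk).signlessLaplacianTensor.hSpec
        (G.powerHypergraph k hk).signlessLaplacianTensor.largestHEigenvalue := fun k hk hke =>
    ((G.powerHypergraph k hk).signlessLaplacianTensor_isGreatest hke (by omega)).1
  have hL : ∀ (k : ℕ) (hk : 4 ≤ k), Even k →
      (G.powerHypergraph k (by omega)).laplacianTensor.hSpec =
        (G.powerHypergraph k (by omega)).signlessLaplacianTensor.hSpec := fun k hk hke =>
    G.hSpec_laplacianTensor_powerHypergraph k (by omega) hk hke
  have hlt := G.largestHEigenvalue_powerHypergraph_lt hΔ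
  refine ⟨fun k hk hke => ⟨?_, ?_⟩, hQ, hlt, fun k l hk hl hke hle hkl => ?_⟩
  · rw [HTensor.largestHEigenvalue, hL k hk hke]
    exact hQ k (by omega) hke
  · rw [HTensor.largestHEigenvalue, hL k hk hke, HTensor.largestHEigenvalue]
  · unfold HTensor.largestHEigenvalue
    rw [hL l hl hle, hL k hk hke]
    exact hlt k l (by omega) (by omega) hke hle hkl
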